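/- **Theorem.** Let $G=(V,E)$ be a finite connected simple graph. In the concurrent game $\Gamma_{(x,y)}$, a cop starts at $x\in V$ and a robber at $y\in V$. In every round each of them, simultaneously, stays put or moves to an adjacent vertex. The robber is captured when both are at the same vertex; if they swap their (different) locations in a round, he is captured at the new location of the cop. After a capture nothing moves. A strategy of either player assigns to every finite history of positions a probability distribution on $V$, from which the next move is drawn, independently of the other player's draw (a move to a vertex outside the closed neighbourhood of the present location is ignored); it is memoryless if the distribution depends only on the current position. The payoff, which the cop minimizes and the robber maximizes, is the expected capture time $$v_{(x,y)}(\pi_C,\pi_R)=\mathbb E\sum_{t=0}^{\infty}\mathbf 1[x_t\ne y_t]\in[0,\infty].$$ Then the following hold. 1. Every game $\Gamma_{(x,y)}$ has a value $$\hat v_{(x,y)}=\inf_{\pi_C}\sup_{\pi_R}v_{(x,y)}(\pi_C,\pi_R)=\sup_{\pi_R}\inf_{\pi_C}v_{(x,y)}(\pi_C,\pi_R)\in[0,\infty].$$ 2. There is a memoryless cop strategy $\pi_C^*$ that is optimal for all starting positions: $\sup_{\pi_R}v_{(x,y)}(\pi_C^*,\pi_R)=\hat v_{(x,y)}$ for all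 $(x,y)\in V^2$. For every $\varepsilon>0$ there is a memoryless robber strategy $\pi_R^\varepsilon$ that is $\varepsilon$-optimal for all starting positions: for all $(x,y)\in V^2$, if $\hat v_{(x,y)}<\infty$, then $|\hat v_{(x,y)}-\inf_{\pi_C}v_{(x,y)}(\pi_C,\pi_R^\varepsilon)|\le\varepsilon$, and if $\hat v_{(x,y)}=\infty$, then $\inf_{\pi_C}v_{(x,y)}(\pi_C,\pi_R^\varepsilon)\ge 1/\varepsilon$. 3. $V^2$ is the disjoint union of $V_1=\{(x,y):\hat v_{(x,y)}<\infty\}$ and $V_2=\{(x,y):\hat v_{(x,y)}=\infty\}$ (either may be empty). 4. If $c(G)=1$, where $c(G)$ is the cop number of $G$ in the classical turn-based game of cops and robber, then $V_1=V^2$; moreover there are a memoryless cop strategy $\pi_C^{\#}$ and a constant $M<\infty$ such that $v_{(x,y)}(\pi_C^{\#},\pi_R)\le M$ for all $(x,y)\in V^2$ and all robber strategies $\pi_R$. -/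

import Mathlib

open scoped ENNReal NNReal

namespace CopsRobbers

universe u

/-! ### The concurrent game with one cop and one robber -/

/-- A position `(x, y)`: the cop is at `x`, the robber is at `y`. -/
def Position (V : Type u) : Type u := V × V

/-- Every set of positions is measurable. -/
instance (V : Type u) : MeasurableSpace (Position V) := ⊤

instance (V : Type u) : DiscreteMeasurableSpace (Position V) := ⟨fun _ => trivial⟩

instance (V : Type u) [Finite V] : Finite (Position V) := inferInstanceAs (Finite (V × V))

open Classical in
/-- The location of a token at `u` after it attempts to move into `v`: a move outside the closed
neighbourhood of `u` is ignored. -/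
noncomputable def move {V : Type u} (G : SimpleGraph V) (u v : V) : V :=
  if v = u ∨ G.Adj u v then v else u

open Classical in
/-- The transition function: at position `s` the cop attempts to move into `a` and, simultaneously,
the robber attempts to move into `b`. Nothing moves after a capture; if the tokens swap
their (different) locations, the robber is captured at the new location of the cop. -/
noncomputable def transition {V : Type u} (G : SimpleGraph V) (s : Position V) (a b : V) :
    Position V :=
  if s.1 = s.2 then s
  else if move G s.1 a = s.2 ∧ move G s.2 b = s.1 then (move G s.1 a, move G s.1 a)
  else (move G s.1 a, move G s.2 b)

/-- The histories `s₀, …, sₙ`. -/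
abbrev History (V : Type u) (n : ℕ) : Type u := Finset.Iic n → Position V

/-- The current (that is, last) position of a history. -/
def History.current {V : Type u} {n : ℕ} (h : History V n) : Position V :=
  h ⟨n, Finset.mem_Iic.2 le_rfl⟩

/-- A randomized strategy: to each history of any finite length, a probability distribution of
the next move. The same notion serves for the cop and for the robber. -/
abbrev Strategy (V : Type u) : Type u := (n : ℕ) → History V n → PMF V

/-- The next move depends only on the current position. -/
def Strategy.Memoryless {V : Type u} (π : Strategy V) : Prop :=
  ∀ (n : ℕ) (h : History V n), π n h = π 0 (fun _ => h.current)

/-- The law of the position after the history `h`: the two players draw their moves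
independently, from the distributions that their strategies prescribe. -/
noncomputable def nextLaw {V : Type u} (G : SimpleGraph V) (πC πR : Strategy V) (n : ℕ)
    (h : History V n) : PMF (Position V) :=
  (πC n h).bind fun a => (πR n h).map fun b => transition G h.current a b

/-- `nextLaw` as a Markov kernel. -/
noncomputable def stepKernel {V : Type u} [Finite V] (G : SimpleGraph V) (πC πR : Strategy V)
    (n : ℕ) : ProbabilityTheory.Kernel (History V n) (Position V) :=
  ProbabilityTheory.Kernel.ofFunOfCountable fun h => (nextLaw G πC πR n h).toMeasure

instance {V : Type u} [Finite V] (G : SimpleGraph V) (πC πR : Strategy V) (n : ℕ) :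
    ProbabilityTheory.IsMarkovKernel (stepKernel G πC πR n) :=
  ⟨fun h => inferInstanceAs (MeasureTheory.IsProbabilityMeasure (nextLaw G πC πR n h).toMeasure)⟩

/-- The probability measure on infinite histories that two strategies induce from the initial
position `s` (Ionescu-Tulcea). -/
noncomputable def playMeasure {V : Type u} [Finite V] (G : SimpleGraph V) (πC πR : Strategy V)
    (s : Position V) : MeasureTheory.Measure (ℕ → Position V) :=
  ProbabilityTheory.Kernel.traj (X := fun _ => Position V) (stepKernel G πC πR) 0 (fun _ => s)

open Classical in
/-- The payment of one round: `1` if the robber is free, and `0` if he is captured. -/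
noncomputable def reward {V : Type u} (s : Position V) : ℝ≥0∞ := if s.1 = s.2 then 0 else 1

/-- The payoff to the robber, which is the expected capture time (possibly `∞`). -/
noncomputable def payoff {V : Type u} [Finite V] (G : SimpleGraph V) (s : Position V)
    (πC πR : Strategy V) : ℝ≥0∞ :=
  ∫⁻ ω, ∑' t, reward (ω t) ∂(playMeasure G πC πR s)

/-- `inf` over cop strategies of `sup` over robber strategies. -/
noncomputable def upperValue {V : Type u} [Finite V] (G : SimpleGraph V) (s : Position V) : ℝ≥0∞ :=
  ⨅ πC : Strategy V, ⨆ πR : Strategy V, payoff G s πC πR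

/-- `sup` over robber strategies of `inf` over cop strategies. -/
noncomputable def lowerValue {V : Type u} [Finite V] (G : SimpleGraph V) (s : Position V) : ℝ≥0∞ :=
  ⨆ πR : Strategy V, ⨅ πC : Strategy V, payoff G s πC πR

/-- `v` is the value of the game that starts at `s`. -/
def IsValue {V : Type u} [Finite V] (G : SimpleGraph V) (s : Position V) (v : ℝ≥0∞) : Prop :=
  upperValue G s = v ∧ lowerValue G s = v

/-- `w` is within `ε` of `v`: this means `|v - w| ≤ ε` if `v` is finite, and `w ≥ 1 / ε` if `v` is
infinite (so `w = ∞` if also `ε = 0`). -/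
def Within (ε : ℝ≥0) (v w : ℝ≥0∞) : Prop :=
  (v ≠ ∞ → v ≤ w + ε ∧ w ≤ v + ε) ∧ (v = ∞ → (ε : ℝ≥0∞)⁻¹ ≤ w)

/-- `π` is an `ε`-optimal cop strategy in the game that starts at `s` and has value `v`. -/
def CopOptimal {V : Type u} [Finite V] (G : SimpleGraph V) (s : Position V) (v : ℝ≥0∞) (ε : ℝ≥0)
    (π : Strategy V) : Prop :=
  Within ε v (⨆ πR : Strategy V, payoff G s π πR)

/-- `π` is an `ε`-optimal robber strategy in the game that starts at `s` and has value `v`. -/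
def RobberOptimal {V : Type u} [Finite V] (G : SimpleGraph V) (s : Position V) (v : ℝ≥0∞) (ε : ℝ≥0)
    (π : Strategy V) : Prop :=
  Within ε v (⨅ πC : Strategy V, payoff G s πC π)

/-! ### The turn-based game and the cop number -/

/-- The locations of `K` cops and of the robber, in the turn-based game. -/
abbrev TurnPosition (V : Type u) (K : ℕ) : Type u := (Fin K → V) × V

/-- Some cop is at the location of the robber. -/
def Captured {V : Type u} {K : ℕ} (p : TurnPosition V K) : Prop := ∃ i, p.1 i = p.2

open Classical in
/-- The cops' turn: cop `i` attempts to move into `a i`. Nothing moves after a capture. -/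
noncomputable def copsTurn {V : Type u} {K : ℕ} (G : SimpleGraph V) (p : TurnPosition V K)
    (a : Fin K → V) : TurnPosition V K :=
  if Captured p then p else (fun i => move G (p.1 i) (a i), p.2)

open Classical in
/-- The robber's turn: he attempts to move into `b`. Nothing moves after a capture. -/
noncomputable def robberTurn {V : Type u} {K : ℕ} (G : SimpleGraph V) (p : TurnPosition V K)
    (b : V) : TurnPosition V K :=
  if Captured p then p else (p.1, move G p.2 b)

/-- A deterministic strategy of the cops in the turn-based game: their next moves, given the list
of the positions at the ends of the earlier rounds (latest first) and the current position. -/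
abbrev TurnStrategy (V : Type u) (K : ℕ) : Type u :=
  List (TurnPosition V K) → TurnPosition V K → (Fin K → V)

/-- The turn-based play, round by round: the list of the earlier positions and the position at the
end of round `t`. The cops choose the initial locations `x₀`; then the robber chooses his initial
location `b 0`. In round `t + 1` first the cops move, by `σ`, and then the robber attempts to move
into `b (t + 1)`. -/
noncomputable def turnPlay {V : Type u} {K : ℕ} (G : SimpleGraph V) (x₀ : Fin K → V)
    (σ : TurnStrategy V K) (b : ℕ → V) : ℕ → List (TurnPosition V K) × TurnPosition V K
  | 0 => ([], (x₀, b 0))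
  | t + 1 =>
    let h := turnPlay G x₀ σ b t
    (h.2 :: h.1, robberTurn G (copsTurn G h.2 (σ h.1 h.2)) (b (t + 1)))

/-- `K` cops can ensure the capture of the robber. As `x₀` and `σ` are deterministic,
it is the same to quantify over the strategies of the robber and over the
sequences `b` of his choices. -/
def CopsWin {V : Type u} (G : SimpleGraph V) (K : ℕ) : Prop :=
  ∃ (x₀ : Fin K → V) (σ : TurnStrategy V K), ∀ b : ℕ → V, ∃ t, Captured (turnPlay G x₀ σ b t).2

/-- The cop number `c(G)`. -/
noncomputable def copNumber {V : Type u} (G : SimpleGraph V) : ℕ :=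
  sInf {K : ℕ | 1 ≤ K ∧ CopsWin G K}

end CopsRobbers

namespace CopsRobbers

universe u

/-! ### Matrix games -/

/-! The value is `limitValue`, the increasing limit of the values `approx G 1 n` of the games of `n`
rounds, each obtained from the previous one by solving a matrix game at every position. Cop:
compactness yields, at each position, one mixed move good against all `n` at once, so `limitValue`
satisfies a Bellman inequality (`exists_expect_limitValue_le`). Iterated along a play, it bounds the
payoff against every robber strategy (`payoff_stationary_le`). Robber: for a discount factor `r <
1`, mixed moves optimal in the matrix games of `approx G r n` guarantee `approx G r n` in the
undiscounted game, since the remainder after `N` rounds is at most a constant times `r ^ N`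
(`le_payoff_stationary`). Taking `n` large and then `r` close to `1` approaches `limitValue`,
simultaneously at the finitely many positions. If `c(G) = 1`, backward induction and connectedness
bound the length of the turn-based game from every position. In the concurrent game a uniformly
random cop move is, with probability at least `1 / |V|`, a winning reply to the robber's
simultaneous move. An exponential potential in the remaining length turns this into a uniform bound
(`exists_potential`). -/

theorem exists_mixed_row_le {α β : Type*} [Fintype α] [Fintype β] [Nonempty α]
    (A : α → β → ℝ) (c : ℝ)
    (h : ∀ p ∈ stdSimplex ℝ α, ∃ b, c ≤ ∑ a, p a * A a b) :
    ∃ q ∈ stdSimplex ℝ β, ∀ a, c ≤ ∑ b, q b * A a b := by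
  classical
  let L : (α → ℝ) →ₗ[ℝ] (β → ℝ) := Matrix.vecMulLinear (Matrix.of A)
  have hL : ∀ p b, L p b = ∑ a, p a * A a b := fun p b => by
    simp [L, Matrix.vecMul, dotProduct]
  -- Separate the open orthant below `c` from the payoff vectors of the row mixtures; the normal `g`
  -- of the hyperplane, rescaled to total mass one, is the column mixture.
  let s : Set (β → ℝ) := Set.pi Set.univ fun _ => Set.Iio c
  have hs : Convex ℝ s := convex_pi fun _ _ => convex_Iio c
  have hso : IsOpen s := isOpen_set_pi Set.finite_univ fun _ _ => isOpen_Iio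
  have hdisj : Disjoint s (L '' stdSimplex ℝ α) := by
    rw [Set.disjoint_left]
    rintro _ hz ⟨p, hp, rfl⟩
    obtain ⟨b, hb⟩ := h p hp
    have := hz b trivial
    rw [Set.mem_Iio, hL] at this
    exact absurd hb (not_le.2 this)
  obtain ⟨f, u, hfs, hft⟩ := geometric_hahn_banach_open hs hso
    ((convex_stdSimplex ℝ α).linear_image L) hdisj
  let g : β → ℝ := fun b => f (Pi.single b 1)
  have hfg : ∀ z, f z = ∑ b, z b * g b := fun z => by
    conv_lhs => rw [pi_eq_sum_univ' z]
    simp only [map_sum, map_smul, smul_eq_mul, g]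
  have hconst : ∀ ε > 0, (c - ε) * ∑ b, g b < u := fun ε hε => by
    have := hfs (fun _ => c - ε) fun b _ => by simpa using hε
    rwa [hfg, ← Finset.mul_sum] at this
  have hg : ∀ b, 0 ≤ g b := fun b => by
    by_contra! hb
    have h1 := hconst 1 one_pos
    -- If `g b < 0`, lowering coordinate `b` stays in the orthant and raises `f`; this `k` makes `f`
    -- reach `u` exactly, which is forbidden.
    set k := (u - (c - 1) * ∑ b, g b) / (- g b) with hk
    have hk0 : 0 ≤ k := div_nonneg (by linarith) (by linarith)
    have := hfs ((fun _ => c - 1) - k • Pi.single b 1) fun b' _ => by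
      by_cases hbb : b' = b
      · subst hbb
        simp
        linarith
      · simp [hbb]
    rw [map_sub, map_smul, hfg, ← Finset.mul_sum, smul_eq_mul] at this
    change _ - k * g b < u at this
    have hkg : k * g b = -(u - (c - 1) * ∑ b, g b) := by
      rw [hk, div_neg, neg_mul, div_mul_cancel₀ _ hb.ne]
    linarith
  have hrow : ∀ a, u ≤ ∑ b, g b * A a b := fun a => by
    have := hft _ ⟨_, single_mem_stdSimplex ℝ a, rfl⟩
    rw [hfg] at this
    refine this.trans (le_of_eq (Finset.sum_congr rfl fun b _ => ?_))
    rw [hL, mul_comm]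
    simp [Pi.single_apply]
  have hG : 0 < ∑ b, g b := by
    refine lt_of_le_of_ne (Finset.sum_nonneg fun b _ => hg b) fun h0 => ?_
    have hz : ∀ b, g b = 0 := fun b =>
      (Finset.sum_eq_zero_iff_of_nonneg fun b _ => hg b).1 h0.symm b (Finset.mem_univ b)
    have h1 := hconst 1 one_pos
    have h2 := hrow (Classical.arbitrary α)
    simp only [hz] at h1 h2
    simp at h1 h2
    linarith
  have hcG : c * ∑ b, g b ≤ u := by
    refine le_of_forall_pos_le_add fun ε hε => ?_
    have := hconst (ε / ∑ b, g b) (div_pos hε hG)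
    rw [sub_mul, div_mul_cancel₀ _ hG.ne'] at this
    linarith
  refine ⟨fun b => g b / ∑ b, g b, ⟨fun b => div_nonneg (hg b) hG.le, ?_⟩, fun a => ?_⟩
  · rw [← Finset.sum_div, div_self hG.ne']
  · simp only [div_mul_eq_mul_div]
    rw [← Finset.sum_div, le_div_iff₀ hG]
    exact hcG.trans (hrow a)

/-- The expectation of `f` under `p`. -/
noncomputable def expect {V : Type u} [Fintype V] (p : PMF V) (f : V → ℝ≥0∞) : ℝ≥0∞ :=
  ∑ a, p a * f a

section expect

variable {V : Type u} [Fintype V]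

theorem sum_pmf (p : PMF V) : ∑ a, p a = 1 := by
  rw [← tsum_fintype (L := SummationFilter.unconditional V), p.tsum_coe]

theorem expect_mono (p : PMF V) {f g : V → ℝ≥0∞} (h : ∀ a, f a ≤ g a) :
    expect p f ≤ expect p g :=
  Finset.sum_le_sum fun a _ => mul_le_mul_right (h a) _

theorem expect_const (p : PMF V) (c : ℝ≥0∞) : expect p (fun _ => c) = c := by
  rw [expect, ← Finset.sum_mul, sum_pmf, one_mul]

theorem expect_add (p : PMF V) (f g : V → ℝ≥0∞) :
    expect p (fun a => f a + g a) = expect p f + expect p g := by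
  simp only [expect, mul_add, Finset.sum_add_distrib]

theorem expect_const_mul (p : PMF V) (c : ℝ≥0∞) (f : V → ℝ≥0∞) :
    expect p (fun a => c * f a) = c * expect p f := by
  simp only [expect, Finset.mul_sum, mul_left_comm]

theorem expect_comm (p q : PMF V) (f : V → V → ℝ≥0∞) :
    expect p (fun a => expect q (f a)) = expect q fun b => expect p fun a => f a b := by
  simp only [expect, Finset.mul_sum]
  rw [Finset.sum_comm]
  simp only [mul_left_comm]

theorem expect_iSup (p : PMF V) (f : ℕ → V → ℝ≥0∞) (hf : Monotone f) :
    expect p (fun a => ⨆ n, f n a) = ⨆ n, expect p (f n) := by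
  simp only [expect, ENNReal.mul_iSup]
  exact ENNReal.finsetSum_iSup_of_monotone fun a m n h => mul_le_mul_right (hf h a) _

/-- The value of the matrix game `A`, for the row player, who minimizes. -/
noncomputable def gameValue (A : V → V → ℝ≥0∞) : ℝ≥0∞ :=
  ⨅ p : PMF V, ⨆ b, expect p fun a => A a b

theorem gameValue_mono {A B : V → V → ℝ≥0∞} (h : ∀ a b, A a b ≤ B a b) :
    gameValue A ≤ gameValue B :=
  iInf_mono fun p => iSup_mono fun b => expect_mono p fun a => h a b

theorem gameValue_le [Nonempty V] {A : V → V → ℝ≥0∞} {c : ℝ≥0∞} (h : ∀ a b, A a b ≤ c) :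
    gameValue A ≤ c :=
  (iInf_le _ (PMF.pure (Classical.arbitrary V))).trans <| iSup_le fun b =>
    (expect_mono _ fun a => h a b).trans (expect_const _ c).le

theorem mul_gameValue_le (c : ℝ≥0∞) (A : V → V → ℝ≥0∞) :
    c * gameValue A ≤ gameValue fun a b => c * A a b :=
  le_iInf fun p => by
    simp only [expect_const_mul, ← ENNReal.mul_iSup]
    exact mul_le_mul_right (iInf_le _ p) _

theorem isCompact_setOf_sum_eq_one : IsCompact {p : V → ℝ≥0∞ | ∑ a, p a = 1} :=
  (isClosed_eq (continuous_finsetSum _ fun a _ => continuous_apply a)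
    continuous_const).isCompact

theorem continuous_sum_mul {f : V → ℝ≥0∞} (hf : ∀ a, f a ≠ ∞) :
    Continuous fun p : V → ℝ≥0∞ => ∑ a, p a * f a :=
  continuous_finsetSum _ fun a _ => (ENNReal.continuous_mul_const (hf a)).comp (continuous_apply a)

/-- The infimum is attained: the worst-case cost is lower semicontinuous on the compact set of
distributions. Finite entries are needed for continuity, as multiplication by `∞` is discontinuous
at `0`. -/
theorem exists_expect_le_gameValue [Nonempty V] {A : V → V → ℝ≥0∞} (hA : ∀ a b, A a b ≠ ∞) :
    ∃ p : PMF V, ∀ b, expect p (fun a => A a b) ≤ gameValue A := by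
  have hlsc : LowerSemicontinuous fun p : V → ℝ≥0∞ => ⨆ b, ∑ a, p a * A a b :=
    lowerSemicontinuous_iSup fun b => (continuous_sum_mul fun a => hA a b).lowerSemicontinuous
  obtain ⟨p, hp, hmin⟩ := (hlsc.lowerSemicontinuousOn {p | ∑ a, p a = 1}).exists_isMinOn
    ⟨⇑(PMF.pure (Classical.arbitrary V)), sum_pmf (PMF.pure (Classical.arbitrary V))⟩
    isCompact_setOf_sum_eq_one
  refine ⟨PMF.ofFintype p hp, fun b => le_iInf fun p' => ?_⟩
  exact (le_iSup (fun b => ∑ a, p a * A a b) b).trans (hmin (sum_pmf p'))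

/-- The minimax theorem, transferred from real matrices. -/
theorem exists_gameValue_le_expect [Nonempty V] {A : V → V → ℝ≥0∞} (hA : ∀ a b, A a b ≠ ∞) :
    ∃ q : PMF V, ∀ a, gameValue A ≤ expect q (A a) := by
  have hsum : ∀ p ∈ stdSimplex ℝ V, ∑ a, ENNReal.ofReal (p a) = 1 := fun p hp => by
    rw [← ENNReal.ofReal_sum_of_nonneg fun a _ => hp.1 a, hp.2, ENNReal.ofReal_one]
  have hex : ∀ p (hp : p ∈ stdSimplex ℝ V) (f : V → ℝ≥0∞), (∀ a, f a ≠ ∞) →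
      expect (PMF.ofFintype _ (hsum p hp)) f = ENNReal.ofReal (∑ a, p a * (f a).toReal) := by
    intro p hp f hf
    rw [ENNReal.ofReal_sum_of_nonneg fun a _ => mul_nonneg (hp.1 a) ENNReal.toReal_nonneg]
    refine Finset.sum_congr rfl fun a _ => ?_
    rw [PMF.ofFintype_apply, ENNReal.ofReal_mul (hp.1 a), ENNReal.ofReal_toReal (hf a)]
  obtain ⟨q, hq, hle⟩ := exists_mixed_row_le (fun a b => (A a b).toReal) (gameValue A).toReal
    fun p hp => by
      obtain ⟨b, hb⟩ := exists_eq_ciSup_of_finite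
        (f := fun b => expect (PMF.ofFintype _ (hsum p hp)) fun a => A a b)
      refine ⟨b, ?_⟩
      have hle : gameValue A ≤ _ := (iInf_le _ (PMF.ofFintype _ (hsum p hp))).trans hb.ge
      rw [hex p hp _ fun a => hA a b] at hle
      exact ENNReal.toReal_le_of_le_ofReal
        (Finset.sum_nonneg fun a _ => mul_nonneg (hp.1 a) ENNReal.toReal_nonneg) hle
  have hfin : gameValue A ≠ ∞ := by
    refine ne_top_of_le_ne_top (b := ∑ a, ∑ b, A a b) ?_ (gameValue_le fun a b => ?_)
    · simp [hA]
    · exact (Finset.single_le_sum (fun b _ => zero_le) (Finset.mem_univ b)).trans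
        (Finset.single_le_sum (f := fun a => ∑ b, A a b) (fun b _ => zero_le) (Finset.mem_univ a))
  refine ⟨PMF.ofFintype _ (hsum q hq), fun a => ?_⟩
  rw [hex q hq _ (hA a)]
  exact ENNReal.le_ofReal_iff_toReal_le hfin
    (Finset.sum_nonneg fun b _ => mul_nonneg (hq.1 b) ENNReal.toReal_nonneg) |>.2 (hle a)

end expect

/-! ### The law of a play -/

/-- The memoryless strategy that draws from `p s` at the position `s`. -/
def stationary {V : Type u} (p : Position V → PMF V) : Strategy V := fun _ h => p h.current

theorem stationary_memoryless {V : Type u} (p : Position V → PMF V) : (stationary p).Memoryless :=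
  fun _ _ => rfl

section play

open MeasureTheory ProbabilityTheory

variable {V : Type u} [Fintype V] (G : SimpleGraph V)

theorem lintegral_nextLaw (πC πR : Strategy V) (n : ℕ) (h : History V n) (f : Position V → ℝ≥0∞) :
    ∫⁻ s, f s ∂(nextLaw G πC πR n h).toMeasure =
      expect (πC n h) fun a => expect (πR n h) fun b => f (transition G h.current a b) := by
  have hbind : ∀ {α β : Type u} (p : PMF α) (k : α → PMF β) (f : β → ℝ≥0∞),
      ∑' s, p.bind k s * f s = ∑' a, p a * ∑' s, k a s * f s := by
    intro α β p k f
    simp only [PMF.bind_apply, ← ENNReal.tsum_mul_right, ← ENNReal.tsum_mul_left]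
    rw [ENNReal.tsum_comm]
    simp only [mul_assoc]
  have hpure : ∀ {β : Type u} (b : β) (f : β → ℝ≥0∞), ∑' s, PMF.pure b s * f s = f b := by
    intro β b f
    rw [tsum_eq_single b fun b' hb => by simp [hb]]
    simp
  have : Fintype (Position V) := Fintype.ofFinite _
  rw [lintegral_countable']
  simp only [PMF.toMeasure_apply_singleton _ _ (measurableSet_singleton _), mul_comm (f _)]
  rw [nextLaw, hbind]
  simp only [← PMF.bind_pure_comp, hbind, Function.comp, hpure, tsum_fintype, expect]

/-- Conditioning on the history up to time `n`. With the case of time `0`, this is all that the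
payoff estimates use about the evolution of the play. -/
theorem lintegral_playMeasure_succ (πC πR : Strategy V) (s : Position V) (n : ℕ)
    (f : Position V → ℝ≥0∞) :
    ∫⁻ ω, f (ω (n + 1)) ∂playMeasure G πC πR s =
      ∫⁻ ω, expect (πC n (Preorder.frestrictLe n ω)) (fun a =>
        expect (πR n (Preorder.frestrictLe n ω)) fun b => f (transition G (ω n) a b))
        ∂playMeasure G πC πR s := by
  have hf : Measurable f := measurable_of_countable f
  have hfn : Measurable fun ω : ℕ → Position V => f (ω (n + 1)) := by fun_prop
  have hk : ∀ h : History V n, ∫⁻ ω, f (ω (n + 1))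
      ∂Kernel.traj (X := fun _ => Position V) (stepKernel G πC πR) n h =
      expect (πC n h) fun a => expect (πR n h) fun b => f (transition G h.current a b) := by
    intro h
    rw [← lintegral_nextLaw]
    change _ = ∫⁻ s, f s ∂(stepKernel G πC πR n h)
    rw [← Kernel.map_traj_succ_self (X := fun _ => Position V) (κ := stepKernel G πC πR),
      Kernel.map_apply _ (by fun_prop), lintegral_map hf (by fun_prop)]
  unfold playMeasure
  conv_lhs => rw [← Kernel.traj_comp_partialTraj (zero_le (a := n)),
    Kernel.lintegral_comp _ _ _ hfn]
  simp only [hk]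
  rw [← Kernel.traj_map_frestrictLe, Kernel.map_apply _ (Preorder.measurable_frestrictLe n),
    lintegral_map (measurable_of_countable _) (Preorder.measurable_frestrictLe n)]
  rfl

theorem lintegral_playMeasure_zero (πC πR : Strategy V) (s : Position V) (f : Position V → ℝ≥0∞) :
    ∫⁻ ω, f (ω 0) ∂playMeasure G πC πR s = f s := by
  have hf : Measurable fun h : History V 0 => f h.current := measurable_of_countable _
  have h := Kernel.traj_map_frestrictLe_apply (X := fun _ => Position V)
    (κ := stepKernel G πC πR) 0 0 (fun _ => s)
  rw [Kernel.partialTraj_self, Kernel.id_apply] at h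
  have h2 := lintegral_map (μ := playMeasure G πC πR s) hf (Preorder.measurable_frestrictLe 0)
  unfold playMeasure at h2 ⊢
  rw [h, lintegral_dirac' _ hf] at h2
  exact h2.symm

theorem measurable_reward_apply (t : ℕ) : Measurable fun ω : ℕ → Position V => reward (ω t) :=
  (measurable_of_countable reward).comp (measurable_pi_apply (X := fun _ => Position V) t)

theorem payoff_eq_tsum (πC πR : Strategy V) (s : Position V) :
    payoff G s πC πR = ∑' t, ∫⁻ ω, reward (ω t) ∂playMeasure G πC πR s :=
  lintegral_tsum fun t =>
    (measurable_reward_apply t).aemeasurable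

/-- The sum of the first rewards plus the expectation of `f` at time `N` is nonincreasing in `N`. As
`hf` holds for each fixed move `b`, it may be averaged over any history-dependent choice of the
robber. -/
theorem payoff_stationary_le {p : Position V → PMF V} {f : Position V → ℝ≥0∞}
    (hf : ∀ s b, reward s + expect (p s) (fun a => f (transition G s a b)) ≤ f s)
    (s : Position V) (πR : Strategy V) : payoff G s (stationary p) πR ≤ f s := by
  rw [payoff_eq_tsum]
  refine ENNReal.tsum_le_of_sum_range_le fun N => ?_
  refine le_self_add.trans (b := _ + ∫⁻ ω, f (ω N) ∂playMeasure G (stationary p) πR s) ?_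
  induction N with
  | zero => simp [lintegral_playMeasure_zero]
  | succ N ih =>
    refine le_trans ?_ ih
    rw [Finset.sum_range_succ, add_assoc, lintegral_playMeasure_succ,
      ← lintegral_add_left (measurable_reward_apply N)]
    refine add_le_add_right (lintegral_mono fun ω => ?_) _
    rw [expect_comm, ← expect_const (πR N (Preorder.frestrictLe N ω)) (reward (ω N)),
      ← expect_add, ← expect_const (πR N (Preorder.frestrictLe N ω)) (f (ω N))]
    exact expect_mono _ fun b => hf (ω N) b

theorem le_payoff_stationary {q : Position V → PMF V} {w : Position V → ℝ≥0∞} {r : ℝ≥0∞}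
    (hr : r < 1) (hw : ∀ s, w s ≠ ∞)
    (hf : ∀ s a, w s ≤ reward s + r * expect (q s) (fun b => w (transition G s a b)))
    (s : Position V) (πC : Strategy V) : w s ≤ payoff G s πC (stationary q) := by
  have : Fintype (Position V) := Fintype.ofFinite _
  set μ := playMeasure G πC (stationary q) s with hμ
  have : IsProbabilityMeasure μ := by
    rw [hμ]; unfold playMeasure; infer_instance
  -- The rewards are left undiscounted, which only increases the right side; the discount serves to
  -- kill the remainder.
  have key : ∀ N, w s ≤ ∑ t ∈ Finset.range N, ∫⁻ ω, reward (ω t) ∂μ +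
      r ^ N * ∫⁻ ω, w (ω N) ∂μ := by
    intro N
    induction N with
    | zero => simp [hμ, lintegral_playMeasure_zero]
    | succ N ih =>
      refine ih.trans ?_
      rw [Finset.sum_range_succ, add_assoc, pow_succ, mul_assoc]
      refine add_le_add_right ?_ _
      have hstep : ∫⁻ ω, w (ω N) ∂μ ≤ ∫⁻ ω, reward (ω N) ∂μ + r * ∫⁻ ω, w (ω (N + 1)) ∂μ := by
        rw [hμ, lintegral_playMeasure_succ, ← lintegral_const_mul' _ _ hr.ne_top,
          ← lintegral_add_left (measurable_reward_apply N)]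
        refine lintegral_mono fun ω => ?_
        rw [← expect_const_mul, ← expect_const (πC N (Preorder.frestrictLe N ω)) (reward (ω N)),
          ← expect_add, ← expect_const (πC N (Preorder.frestrictLe N ω)) (w (ω N))]
        exact expect_mono _ fun a => hf (ω N) a
      refine (mul_le_mul_right hstep _).trans ?_
      rw [mul_add]
      refine add_le_add_left ?_ _
      exact mul_le_of_le_one_left' (pow_le_one' hr.le N)
  have hC : ∑ s, w s ≠ ∞ := by simp [hw]
  have hlim : Filter.Tendsto (fun N : ℕ => payoff G s πC (stationary q) + r ^ N * ∑ s, w s)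
      Filter.atTop (nhds (payoff G s πC (stationary q) + 0 * ∑ s, w s)) :=
    tendsto_const_nhds.add (ENNReal.Tendsto.mul_const
      (ENNReal.tendsto_pow_atTop_nhds_zero_of_lt_one hr) (Or.inr hC))
  rw [zero_mul, add_zero] at hlim
  refine ge_of_tendsto' hlim fun N => (key N).trans (add_le_add ?_ (mul_le_mul_right ?_ _))
  · rw [payoff_eq_tsum]
    exact ENNReal.sum_le_tsum _
  · calc ∫⁻ ω, w (ω N) ∂μ ≤ ∫⁻ _, ∑ s, w s ∂μ :=
          lintegral_mono fun ω => Finset.single_le_sum (fun _ _ => zero_le) (Finset.mem_univ (ω N))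
      _ = ∑ s, w s := by simp

end play

/-! ### Values of finite and of discounted games -/

section approx

open Filter Topology

variable {V : Type u} [Fintype V] (G : SimpleGraph V)

/-- The value of the game of `n` rounds with discount factor `r`. -/
noncomputable def approx (r : ℝ≥0∞) : ℕ → Position V → ℝ≥0∞
  | 0 => fun _ => 0
  | n + 1 => fun s => reward s + r * gameValue fun a b => approx r n (transition G s a b)

theorem approx_succ (r : ℝ≥0∞) (n : ℕ) (s : Position V) : approx G r (n + 1) s =
    reward s + r * gameValue fun a b => approx G r n (transition G s a b) := rfl

theorem approx_mono (r : ℝ≥0∞) : Monotone (approx G r) := by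
  refine monotone_nat_of_le_succ fun n => ?_
  induction n with
  | zero => exact fun s => zero_le
  | succ n ih =>
    intro s
    have h := gameValue_mono fun a b => ih (transition G s a b)
    rw [approx_succ G r n, approx_succ G r (n + 1)]
    gcongr

theorem approx_le [Nonempty V] {r : ℝ≥0∞} (hr : r ≤ 1) (n : ℕ) (s : Position V) :
    approx G r n s ≤ n := by
  induction n generalizing s with
  | zero => simp [approx]
  | succ n ih =>
    rw [approx_succ, Nat.cast_succ, add_comm (n : ℝ≥0∞)]
    refine add_le_add ?_ ?_
    · unfold reward
      split_ifs <;> simp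
    · exact (mul_le_of_le_one_left' hr).trans (gameValue_le fun a b => ih _)

theorem approx_ne_top [Nonempty V] {r : ℝ≥0∞} (hr : r ≤ 1) (n : ℕ) (s : Position V) :
    approx G r n s ≠ ∞ :=
  ne_top_of_le_ne_top (ENNReal.natCast_ne_top n) (approx_le G hr n s)

/-- In `n` rounds every reward keeps at least the weight `r ^ n`. -/
theorem pow_mul_approx_one_le {r : ℝ≥0∞} (hr : r ≤ 1) (n : ℕ) (s : Position V) :
    r ^ n * approx G 1 n s ≤ approx G r n s := by
  induction n generalizing s with
  | zero => simp [approx]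
  | succ n ih =>
    rw [approx_succ, approx_succ, one_mul, mul_add]
    refine add_le_add (mul_le_of_le_one_left' (pow_le_one' hr _)) ?_
    rw [pow_succ', mul_assoc]
    exact mul_le_mul_right ((mul_gameValue_le _ _).trans (gameValue_mono fun a b => ih _)) _

theorem exists_approx_le_payoff [Nonempty V] {r : ℝ≥0∞} (hr : r < 1) (n : ℕ) :
    ∃ q : Position V → PMF V, ∀ s πC, approx G r n s ≤ payoff G s πC (stationary q) := by
  choose q hq using fun s : Position V => exists_gameValue_le_expect
    (A := fun a b => approx G r n (transition G s a b)) fun a b => approx_ne_top G hr.le n _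
  refine ⟨q, le_payoff_stationary G hr (approx_ne_top G hr.le n) fun s a => ?_⟩
  -- Monotonicity in `n` makes `approx G r n` a subsolution of its own recursion, so one stationary
  -- choice works in all rounds.
  exact (approx_mono G r n.le_succ s).trans (add_le_add_right (mul_le_mul_right (hq s a) _) _)

theorem eventually_lt_approx [Nonempty V] {c : ℝ≥0∞} {n : ℕ} {s : Position V}
    (h : c < approx G 1 n s) : ∀ᶠ r in 𝓝[<] (1 : ℝ≥0∞), c < approx G r n s := by
  have hlim : Tendsto (fun r : ℝ≥0∞ => r ^ n * approx G 1 n s) (𝓝 1)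
      (𝓝 (1 ^ n * approx G 1 n s)) :=
    ENNReal.Tendsto.mul_const ((ENNReal.continuous_pow n).tendsto 1)
      (Or.inr (approx_ne_top G le_rfl n s))
  rw [one_pow, one_mul] at hlim
  filter_upwards [(hlim.mono_left nhdsWithin_le_nhds).eventually_const_lt h, self_mem_nhdsWithin]
    with r hr hr1
  exact hr.trans_le (pow_mul_approx_one_le G (le_of_lt hr1) n s)

/-- The value of the game of infinitely many rounds, as the limit of those of finitely many. -/
noncomputable def limitValue (s : Position V) : ℝ≥0∞ := ⨆ n, approx G 1 n s

instance nhdsLT_one_neBot : (𝓝[<] (1 : ℝ≥0∞)).NeBot :=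
  nhdsLT_neBot_of_exists_lt ⟨0, one_pos⟩

theorem limitValue_le_lowerValue [Nonempty V] (s : Position V) :
    limitValue G s ≤ lowerValue G s := by
  refine iSup_le fun n => le_of_forall_lt fun c hc => ?_
  obtain ⟨r, hr, hr1⟩ := ((eventually_lt_approx G hc).and self_mem_nhdsWithin).exists
  obtain ⟨q, hq⟩ := exists_approx_le_payoff G hr1 n
  exact hr.trans_le (le_iSup_of_le (stationary q) (le_iInf (hq s)))

theorem exists_stationary_robber [Nonempty V] {ε : ℝ≥0} (hε : 0 < ε) :
    ∃ q : Position V → PMF V, ∀ s πC,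
      (limitValue G s ≠ ∞ → limitValue G s ≤ payoff G s πC (stationary q) + ε) ∧
      (limitValue G s = ∞ → (ε : ℝ≥0∞)⁻¹ ≤ payoff G s πC (stationary q)) := by
  have hε' : (ε : ℝ≥0∞) ≠ 0 := by simpa using hε.ne'
  have key : ∀ s : Position V, ∀ᶠ n in atTop, ∀ᶠ r in 𝓝[<] (1 : ℝ≥0∞),
      (limitValue G s ≠ ∞ → limitValue G s ≤ approx G r n s + ε) ∧
      (limitValue G s = ∞ → (ε : ℝ≥0∞)⁻¹ ≤ approx G r n s) := by
    intro s
    have hlim : Tendsto (fun n => approx G 1 n s) atTop (𝓝 (limitValue G s)) :=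
      tendsto_atTop_iSup fun m n h => approx_mono G 1 h s
    by_cases hs : limitValue G s = ∞
    · have : (ε : ℝ≥0∞)⁻¹ < limitValue G s := by
        rw [hs]
        exact ENNReal.inv_lt_top.2 (pos_iff_ne_zero.2 hε')
      filter_upwards [hlim.eventually_const_lt this] with n hn
      filter_upwards [eventually_lt_approx G hn] with r hr
      exact ⟨fun h => absurd hs h, fun _ => hr.le⟩
    -- At value `0`, subtracting `ε` would not give a strictly smaller number.
    · by_cases h0 : limitValue G s = 0
      · simp [h0]
      have : limitValue G s - ε < limitValue G s := ENNReal.sub_lt_self hs h0 hε'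
      filter_upwards [hlim.eventually_const_lt this] with n hn
      filter_upwards [eventually_lt_approx G hn] with r hr
      exact ⟨fun _ => tsub_le_iff_right.1 hr.le, fun h => absurd h hs⟩
  obtain ⟨n, hn⟩ := (eventually_all.2 key).exists
  obtain ⟨r, hr, hr1⟩ := ((eventually_all.2 hn).and self_mem_nhdsWithin).exists
  obtain ⟨q, hq⟩ := exists_approx_le_payoff G hr1 n
  exact ⟨q, fun s πC => ⟨fun h => ((hr s).1 h).trans (add_le_add_left (hq s πC) _),
    fun h => ((hr s).2 h).trans (hq s πC)⟩⟩

theorem exists_expect_limitValue_le [Nonempty V] (s : Position V) :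
    ∃ p : PMF V, ∀ b,
      reward s + expect p (fun a => limitValue G (transition G s a b)) ≤ limitValue G s := by
  -- `approx G 1 n` replaces `limitValue` because its finiteness makes `K n` closed. These sets are
  -- nested, compact and nonempty; a common point works in the limit by monotone convergence.
  let K : ℕ → Set (V → ℝ≥0∞) := fun n => {p | ∑ a, p a = 1} ∩
    ⋂ b, {p | reward s + ∑ a, p a * approx G 1 n (transition G s a b) ≤ limitValue G s}
  have hclosed : ∀ n, IsClosed (K n) := fun n =>
    isCompact_setOf_sum_eq_one.isClosed.inter <| isClosed_iInter fun b =>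
      isClosed_le (continuous_const.add (continuous_sum_mul fun a => approx_ne_top G le_rfl n _))
        continuous_const
  have hanti : ∀ n, K (n + 1) ⊆ K n := by
    refine fun n => Set.inter_subset_inter_right _ <| Set.iInter_mono fun b p hp => ?_
    rw [Set.mem_ofPred_eq] at hp ⊢
    refine le_trans ?_ hp
    gcongr with a
    exact approx_mono G 1 n.le_succ _
  have hne : ∀ n, (K n).Nonempty := fun n => by
    obtain ⟨p, hp⟩ := exists_expect_le_gameValue
      (A := fun a b => approx G 1 n (transition G s a b)) fun a b => approx_ne_top G le_rfl n _
    refine ⟨p, sum_pmf p, Set.mem_iInter.2 fun b => ?_⟩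
    have h : approx G 1 (n + 1) s ≤ limitValue G s := le_iSup (fun n => approx G 1 n s) (n + 1)
    rw [approx_succ, one_mul] at h
    rw [Set.mem_ofPred_eq]
    exact (add_le_add_right (hp b) _).trans h
  obtain ⟨p, hp⟩ := IsCompact.nonempty_iInter_of_sequence_nonempty_isCompact_isClosed K hanti hne
    (hclosed 0).isCompact hclosed
  rw [Set.mem_iInter] at hp
  refine ⟨PMF.ofFintype p (hp 0).1, fun b => ?_⟩
  have hsup : expect (PMF.ofFintype p (hp 0).1) (fun a => limitValue G (transition G s a b)) =
      ⨆ n, expect (PMF.ofFintype p (hp 0).1) fun a => approx G 1 n (transition G s a b) :=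
    expect_iSup _ (fun n a => approx G 1 n (transition G s a b))
      fun m n h a => approx_mono G 1 h _
  rw [hsup, ENNReal.add_iSup]
  refine iSup_le fun n => ?_
  have hn := Set.mem_iInter.1 (hp n).2 b
  rw [Set.mem_ofPred_eq] at hn
  simpa only [expect, PMF.ofFintype_apply] using hn

theorem exists_stationary_cop [Nonempty V] :
    ∃ p : Position V → PMF V, ∀ s πR, payoff G s (stationary p) πR ≤ limitValue G s := by
  choose p hp using exists_expect_limitValue_le G
  exact ⟨p, payoff_stationary_le G hp⟩

theorem lowerValue_le_upperValue (s : Position V) : lowerValue G s ≤ upperValue G s :=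
  iSup_iInf_le_iInf_iSup fun πR πC => payoff G s πC πR

theorem isValue_limitValue [Nonempty V] (s : Position V) : IsValue G s (limitValue G s) := by
  obtain ⟨p, hp⟩ := exists_stationary_cop G
  have h : upperValue G s ≤ limitValue G s := iInf_le_of_le (stationary p) (iSup_le (hp s))
  exact ⟨h.antisymm ((limitValue_le_lowerValue G s).trans (lowerValue_le_upperValue G s)),
    ((lowerValue_le_upperValue G s).trans h).antisymm (limitValue_le_lowerValue G s)⟩

end approx

/-! ### Cop-win graphs -/

section copWin

variable {V : Type u} (G : SimpleGraph V)

theorem move_self (x : V) : move G x x = x := by simp [move]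

theorem move_of_adj {x y : V} (h : G.Adj x y) : move G x y = y := by simp [move, h]

/-- In the turn-based game with the cop at `x`, the robber at `y` and the cop to move, the cop can
ensure the capture within `n` rounds. -/
def WinsIn : ℕ → V → V → Prop
  | 0, x, y => x = y
  | n + 1, x, y => x = y ∨ ∃ a, move G x a = y ∨ ∀ b, WinsIn n (move G x a) (move G y b)

theorem WinsIn.succ {n : ℕ} {x y : V} (h : WinsIn G n x y) : WinsIn G (n + 1) x y := by
  induction n generalizing x y with
  | zero => exact Or.inl h
  | succ n ih =>
    obtain h | ⟨a, h | h⟩ := h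
    · exact Or.inl h
    · exact Or.inr ⟨a, Or.inl h⟩
    · exact Or.inr ⟨a, Or.inr fun b => ih (h b)⟩

theorem WinsIn.mono {m n : ℕ} (hmn : m ≤ n) {x y : V} (h : WinsIn G m x y) : WinsIn G n x y := by
  induction hmn with
  | refl => exact h
  | step _ ih => exact ih.succ

theorem exists_forall_winsIn {ι : Type*} [Finite ι] {f g : ι → V}
    (h : ∀ i, ∃ n, WinsIn G n (f i) (g i)) : ∃ n, ∀ i, WinsIn G n (f i) (g i) := by
  choose n hn using h
  obtain ⟨N, hN⟩ := (Set.finite_range n).bddAbove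
  exact ⟨N, fun i => (hn i).mono G (hN ⟨i, rfl⟩)⟩

/-- If every reply `b` lost in some number of rounds, finiteness would give a common bound, and `a`
would win. -/
theorem exists_escape [Finite V] {x y : V} (h : ¬ ∃ n, WinsIn G n x y) (a : V) :
    move G x a ≠ y ∧ ∃ b, ¬ ∃ n, WinsIn G n (move G x a) (move G y b) := by
  refine ⟨fun ha => h ⟨1, Or.inr ⟨a, Or.inl ha⟩⟩, ?_⟩
  by_contra! hb
  obtain ⟨n, hn⟩ := exists_forall_winsIn G hb
  exact h ⟨n + 1, Or.inr ⟨a, Or.inr hn⟩⟩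

theorem exists_start_of_copsWin [Finite V] (h : CopsWin G 1) : ∃ x, ∀ y, ∃ n, WinsIn G n x y := by
  obtain ⟨x₀, σ, hσ⟩ := h
  refine ⟨x₀ 0, ?_⟩
  by_contra! hy
  obtain ⟨y₀, hy₀⟩ := hy
  let next : List (TurnPosition V 1) × TurnPosition V 1 → V →
      List (TurnPosition V 1) × TurnPosition V 1 := fun h b =>
    (h.2 :: h.1, robberTurn G (copsTurn G h.2 (σ h.1 h.2)) b)
  have hnc : ∀ p : TurnPosition V 1, (¬ ∃ n, WinsIn G n (p.1 0) p.2) → ¬ Captured p := by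
    rintro p hp ⟨i, hi⟩
    rw [Fin.fin_one_eq_zero i] at hi
    exact hp ⟨0, hi⟩
  have hstep : ∀ h : List (TurnPosition V 1) × TurnPosition V 1, ∃ b,
      (¬ ∃ n, WinsIn G n (h.2.1 0) h.2.2) →
        ¬ ∃ n, WinsIn G n ((next h b).2.1 0) (next h b).2.2 := by
    intro h
    by_cases hw : ∃ n, WinsIn G n (h.2.1 0) h.2.2
    · exact ⟨x₀ 0, fun hn => absurd hw hn⟩
    · obtain ⟨ha, b, hb⟩ := exists_escape G hw (σ h.1 h.2 0)
      refine ⟨b, fun _ => ?_⟩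
      have hc : copsTurn G h.2 (σ h.1 h.2) =
          (fun i => move G (h.2.1 i) (σ h.1 h.2 i), h.2.2) := if_neg (hnc _ hw)
      have hc' : ¬ Captured
          ((fun i => move G (h.2.1 i) (σ h.1 h.2 i), h.2.2) : TurnPosition V 1) := by
        rintro ⟨i, hi⟩
        rw [Fin.fin_one_eq_zero i] at hi
        exact ha hi
      simp only [next, hc]
      rw [robberTurn, if_neg hc']
      exact hb
  choose β hβ using hstep
  -- The play against `σ` in which the robber always answers with the escape `β`; since `σ` is
  -- deterministic, his moves form a fixed sequence `b`.
  let S : ℕ → List (TurnPosition V 1) × TurnPosition V 1 := fun t =>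
    Nat.rec ([], (x₀, y₀)) (fun _ h => next h (β h)) t
  let b : ℕ → V := fun t => Nat.casesOn t y₀ fun t => β (S t)
  have hS : ∀ t, turnPlay G x₀ σ b t = S t := fun t => by
    induction t with
    | zero => rfl
    | succ t ih =>
      rw [turnPlay, ih]
  have hinv : ∀ t, ¬ ∃ n, WinsIn G n ((S t).2.1 0) (S t).2.2 := fun t => by
    induction t with
    | zero => exact fun ⟨n, hn⟩ => hy₀ n hn
    | succ t ih => exact hβ (S t) ih
  obtain ⟨t, ht⟩ := hσ b
  rw [hS] at ht
  exact hnc _ (hinv t) ht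

/-- The cop first walks to `z`; wherever the robber goes meanwhile, the position there is won. -/
theorem exists_winsIn_of_walk [Finite V] {x z : V} (w : G.Walk x z)
    (hz : ∀ y, ∃ n, WinsIn G n z y) : ∀ y, ∃ n, WinsIn G n x y := by
  induction w with
  | nil => exact hz
  | @cons u v _ huv _ ih =>
    intro y
    obtain ⟨n, hn⟩ := exists_forall_winsIn G (f := fun _ : V => v) (ih hz)
    refine ⟨n + 1, Or.inr ⟨v, Or.inr fun b => ?_⟩⟩
    rw [move_of_adj G huv]
    exact hn _

theorem exists_forall_winsIn_of_copsWin [Finite V] (hG : G.Connected) (h : CopsWin G 1) :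
    ∃ n, ∀ x y, WinsIn G n x y := by
  obtain ⟨z, hz⟩ := exists_start_of_copsWin G h
  obtain ⟨n, hn⟩ := exists_forall_winsIn G (ι := V × V) (f := Prod.fst) (g := Prod.snd)
    fun i => exists_winsIn_of_walk G (hG.preconnected i.1 z).some hz i.2
  exact ⟨n, fun x y => hn (x, y)⟩

/-- In the concurrent game at `s`, a cop who knows in advance every next move of the robber can
ensure the capture within `n` rounds. -/
def RankLE : ℕ → Position V → Prop
  | 0, s => s.1 = s.2
  | n + 1, s => s.1 = s.2 ∨ ∀ b, WinsIn G n s.1 (move G s.2 b)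

theorem rankLE_of_eq {s : Position V} (h : s.1 = s.2) (n : ℕ) : RankLE G n s := by
  cases n with
  | zero => exact h
  | succ n => exact Or.inl h

theorem rankLE_transition {s : Position V} (hs : s.1 ≠ s.2) {n : ℕ} {a b : V}
    (h : RankLE G n (move G s.1 a, move G s.2 b)) : RankLE G n (transition G s a b) := by
  have ht : transition G s a b = _ := if_neg hs
  by_cases hswap : move G s.1 a = s.2 ∧ move G s.2 b = s.1
  · rw [ht.trans (if_pos hswap)]
    exact rankLE_of_eq G rfl n
  · rwa [ht.trans (if_neg hswap)]

/-- Knowing `b`, the cop plays the turn-based winning reply as if the robber had already moved. He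
stays put if the robber walks into him; a swap is a capture anyway. -/
theorem RankLE.exists_transition {n : ℕ} {s : Position V} (h : RankLE G (n + 1) s)
    (hs : s.1 ≠ s.2) (b : V) : ∃ a, RankLE G n (transition G s a b) := by
  have hb := h.resolve_left hs b
  have hstay : s.1 = move G s.2 b → ∃ a, RankLE G n (transition G s a b) := fun he =>
    ⟨s.1, rankLE_transition G hs (rankLE_of_eq G ((move_self G s.1).trans he) n)⟩
  cases n with
  | zero => exact hstay hb
  | succ n =>
    obtain he | ⟨a, ha | ha⟩ := hb
    · exact hstay he
    · exact ⟨a, rankLE_transition G hs (rankLE_of_eq G ha _)⟩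
    · exact ⟨a, rankLE_transition G hs (Or.inr ha)⟩

theorem exists_rank {n : ℕ} (hn : ∀ x y, WinsIn G n x y) :
    ∃ ρ : Position V → ℕ, (∀ s, ρ s ≤ n + 1) ∧ (∀ s, s.1 = s.2 → ρ s = 0) ∧
      ∀ s, s.1 ≠ s.2 → ∀ b, ∃ a, ρ (transition G s a b) < ρ s := by
  classical
  have hex : ∀ s, ∃ m, RankLE G m s := fun s => ⟨n + 1, Or.inr fun b => hn _ _⟩
  refine ⟨fun s => Nat.find (hex s), fun s => Nat.find_min' _ (Or.inr fun b => hn _ _),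
    fun s hs => (Nat.find_eq_zero _).2 hs, fun s hs b => ?_⟩
  have hspec := Nat.find_spec (hex s)
  obtain ⟨m, hm⟩ := Nat.exists_eq_succ_of_ne_zero
    (show Nat.find (hex s) ≠ 0 from fun h0 => hs ((Nat.find_eq_zero _).1 h0))
  rw [hm] at hspec
  obtain ⟨a, ha⟩ := RankLE.exists_transition G hspec hs b
  refine ⟨a, ?_⟩
  simp only [hm]
  exact Nat.lt_succ_of_le (Nat.find_min' _ ha)

theorem exists_potential [Fintype V] [Nonempty V] {ρ : Position V → ℕ} {M : ℕ}
    (hM : ∀ s, ρ s ≤ M)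
    (h0 : ∀ s, s.1 = s.2 → ρ s = 0)
    (hρ : ∀ s, s.1 ≠ s.2 → ∀ b, ∃ a, ρ (transition G s a b) < ρ s) :
    ∃ (f : Position V → ℕ) (F : ℕ), (∀ s, f s ≤ F) ∧ (∀ s, s.1 = s.2 → f s = 0) ∧
      ∀ s, s.1 ≠ s.2 → ∀ b,
        Fintype.card V + ∑ a, f (transition G s a b) ≤ Fintype.card V * f s := by
  classical
  set k := Fintype.card V with hk
  have hk0 : 0 < k := Fintype.card_pos
  -- Base `2 * k` suffices: one good move among `k` multiplies `g` by at least `2 * k`, which covers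
  -- `k * g s` for all moves plus the round cost `k`, as `g s ≥ 1`.
  let g : Position V → ℕ := fun s => (2 * k) ^ (M - ρ s)
  have hg : ∀ s, g s ≤ (2 * k) ^ M := fun s =>
    Nat.pow_le_pow_right (by omega) (Nat.sub_le _ _)
  refine ⟨fun s => (2 * k) ^ M - g s, (2 * k) ^ M, fun s => Nat.sub_le _ _, fun s hs => ?_,
    fun s hs b => ?_⟩
  · simp [g, h0 s hs]
  · obtain ⟨a, ha⟩ := hρ s hs b
    have hstep : k + k * g s ≤ g (transition G s a b) := by
      have h1 : 1 ≤ g s := Nat.one_le_pow _ _ (by omega)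
      calc k + k * g s ≤ g s * (2 * k) := by nlinarith
        _ = (2 * k) ^ (M - ρ s + 1) := (pow_succ _ _).symm
        _ ≤ g (transition G s a b) := Nat.pow_le_pow_right (by omega) (by have := hM s; omega)
    have hsum : ∑ a, ((2 * k) ^ M - g (transition G s a b)) + g (transition G s a b) ≤
        k * (2 * k) ^ M := by
      calc _ ≤ ∑ a, ((2 * k) ^ M - g (transition G s a b)) + ∑ a, g (transition G s a b) :=
            Nat.add_le_add_left (Finset.single_le_sum
              (f := fun a => g (transition G s a b)) (fun _ _ => Nat.zero_le _)
              (Finset.mem_univ a)) _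
        _ = ∑ a : V, (2 * k) ^ M := by
            rw [← Finset.sum_add_distrib]
            exact Finset.sum_congr rfl fun a _ => Nat.sub_add_cancel (hg _)
        _ = k * (2 * k) ^ M := by simp [hk]
    change k + ∑ a, ((2 * k) ^ M - g (transition G s a b)) ≤ k * ((2 * k) ^ M - g s)
    rw [Nat.mul_sub]
    omega

theorem exists_bounded_payoff [Fintype V] (hG : G.Connected) (h : CopsWin G 1) :
    ∃ (p : Position V → PMF V) (M : ℕ), ∀ s πR, payoff G s (stationary p) πR ≤ M := by
  have := hG.nonempty
  obtain ⟨n, hn⟩ := exists_forall_winsIn_of_copsWin G hG h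
  obtain ⟨ρ, hM, h0, hρ⟩ := exists_rank G hn
  obtain ⟨f, F, hF, hf0, hf⟩ := exists_potential G hM h0 hρ
  refine ⟨fun _ => PMF.uniformOfFintype V, F, fun s πR =>
    (payoff_stationary_le G (f := fun s => (f s : ℝ≥0∞)) (fun s b => ?_) s πR).trans
      (Nat.cast_le.2 (hF s))⟩
  by_cases hs : s.1 = s.2
  · have ht : ∀ a, transition G s a b = s := fun a => if_pos hs
    simp only [ht, expect_const, reward, if_pos hs, zero_add, le_refl]
  · have hk0 : (Fintype.card V : ℝ≥0∞) ≠ 0 := by simp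
    have hk1 : (Fintype.card V : ℝ≥0∞) ≠ ∞ := ENNReal.natCast_ne_top _
    have hle : ((Fintype.card V : ℝ≥0∞) + ∑ a, (f (transition G s a b) : ℝ≥0∞)) ≤
        Fintype.card V * f s := by
      exact_mod_cast hf s hs b
    simp only [reward, if_neg hs, expect, PMF.uniformOfFintype_apply]
    rw [← Finset.mul_sum, ← ENNReal.inv_mul_cancel hk0 hk1, ← mul_add]
    refine (mul_le_mul_right hle _).trans ?_
    rw [← mul_assoc, ENNReal.inv_mul_cancel hk0 hk1, one_mul]

theorem copsWin_one_of_copNumber (h : copNumber G = 1) : CopsWin G 1 := by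
  -- The infimum of the empty set is `0`, so the value `1` shows that the set is nonempty.
  have := Nat.sInf_mem (s := {K : ℕ | 1 ≤ K ∧ CopsWin G K})
    (Nat.nonempty_of_pos_sInf (one_pos.trans_eq h.symm))
  rw [show sInf {K : ℕ | 1 ≤ K ∧ CopsWin G K} = 1 from h] at this
  exact this.2

end copWin

end CopsRobbers

theorem theorem4p3 {V : Type*} [Finite V] (G : SimpleGraph V) (hG : G.Connected) :
    ∃ v : CopsRobbers.Position V → ENNReal,
      -- every game has a value
      (∀ s, CopsRobbers.IsValue G s (v s)) ∧
      -- the cop has a memoryless strategy that is optimal for all initial positions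
      (∃ πC : CopsRobbers.Strategy V, πC.Memoryless ∧
        ∀ s, CopsRobbers.CopOptimal G s (v s) 0 πC) ∧
      -- the robber has memoryless strategies that are `ε`-optimal for all initial positions
      (∀ ε : NNReal, 0 < ε → ∃ πR : CopsRobbers.Strategy V, πR.Memoryless ∧
        ∀ s, CopsRobbers.RobberOptimal G s (v s) ε πR) ∧
      -- the positions of finite value and those of infinite value partition all positions
      ({s | v s < ⊤} ∪ {s | v s = ⊤} = Set.univ ∧ Disjoint {s | v s < ⊤} {s | v s = ⊤}) ∧
      -- if `c(G) = 1`, then all values are finite, and some memoryless cop strategy has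
      -- a uniformly bounded expected capture time
      (CopsRobbers.copNumber G = 1 →
        {s | v s < ⊤} = Set.univ ∧
        ∃ (πC : CopsRobbers.Strategy V) (M : NNReal), πC.Memoryless ∧
          ∀ s (πR : CopsRobbers.Strategy V), CopsRobbers.payoff G s πC πR ≤ (M : ENNReal)) := by
  classical
  cases nonempty_fintype V
  have := hG.nonempty
  obtain ⟨p, hp⟩ := CopsRobbers.exists_stationary_cop G
  have hval := CopsRobbers.isValue_limitValue G
  refine ⟨CopsRobbers.limitValue G, hval, ⟨_, CopsRobbers.stationary_memoryless p, fun s => ?_⟩,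
    fun ε hε => ?_, ⟨?_, ?_⟩, fun hc => ?_⟩
  · have heq : ⨆ πR, CopsRobbers.payoff G s (CopsRobbers.stationary p) πR =
        CopsRobbers.limitValue G s :=
      (iSup_le (hp s)).antisymm ((hval s).1.symm.le.trans (iInf_le _ _))
    rw [CopsRobbers.CopOptimal, heq]
    -- With `ε = 0`, the bound required at infinite value is `0⁻¹ = ∞`.
    exact ⟨fun _ => by simp, fun h => by simp [h]⟩
  · obtain ⟨q, hq⟩ := CopsRobbers.exists_stationary_robber G hε
    refine ⟨_, CopsRobbers.stationary_memoryless q, fun s => ⟨fun h => ⟨?_, ?_⟩, fun h => ?_⟩⟩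
    · rw [ENNReal.iInf_add]
      exact le_iInf fun πC => (hq s πC).1 h
    · refine le_trans ?_ le_self_add
      exact (le_iSup (fun πR => ⨅ πC, CopsRobbers.payoff G s πC πR) _).trans (hval s).2.le
    · exact le_iInf fun πC => (hq s πC).2 h
  · ext s
    simp [lt_top_iff_ne_top, em']
  · exact Set.disjoint_left.2 fun s h h' => h.ne h'
  · obtain ⟨p', M, hM⟩ :=
      CopsRobbers.exists_bounded_payoff G hG (CopsRobbers.copsWin_one_of_copNumber G hc)
    refine ⟨Set.eq_univ_of_forall fun s => ?_, _, M, CopsRobbers.stationary_memoryless p',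
      by simpa using hM⟩
    exact ((hval s).1.symm.le.trans (iInf_le_of_le _ (iSup_le (hM s)))).trans_lt
      (ENNReal.natCast_lt_top M)
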